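/- Let $Q$ be a real $2\times2$ matrix, $V^0\in C^2(\mathbb R;\mathbb R^2)$, and consider for $\mathbf V=(V_1,V_2)^T(t,x)$ the Cauchy problem $$\mathbf V_t+V_1\mathbf V_x=Q\mathbf V\quad(t\ge 0),\qquad \mathbf V(0,x)=V^0(x).\tag{P}$$ (For $Q=\begin{pmatrix}-\gamma&k\\N&0\end{pmatrix}$, $\mathbf V=(V,E)^T$, this is the transformed Euler--Poisson system $V_t+VV_x=kE-\gamma V$, $E_t+VE_x=NV$.) Let $A=(a_{ij})$ be a nonsingular real matrix and $J=(j_{ik})=AQA^{-1}$ (for instance the real Jordan form of $Q$). For $x_0\in\mathbb R$ consider the linear systems, for $t\ge0$, $$\dot{\bar{\mathbf V}}=Q\bar{\mathbf V},\quad \dot X=\bar V_1,\qquad \bar{\mathbf V}(0)=V^0(x_0),\quad X(0)=x_0,\tag{S1}$$ $$\begin{pmatrix}\dot q\\ \dot u_1\\ \dot u_2\end{pmatrix}=\begin{pmatrix}0&\frac{a_{22}}{\det A}&-\frac{a_{12}}{\det A}\\0&j_{11}&j_{12}\\0&j_{21}&j_{22}\end{pmatrix}\begin{pmatrix}q\\u_1\\u_2\end{pmatrix},\qquad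 q(0)=1,\quad \begin{pmatrix}u_1(0)\\u_2(0)\end{pmatrix}=A\,(V^0)'(x_0).\tag{S2}$$ The function $q(t)=q(t,x_0)$ is called the decisive function; write $X(t,x_0)$ for the component $X$ of (S1). Put $$T_*=\inf\{t>0:\ q(t,x_0)=0\text{ for some }x_0\in\mathbb R\}\in[0,\infty],\qquad \inf\emptyset=\infty .$$ Let $r\in\{1,2\}$. A $C^r$ solution on a relatively open set $U\subseteq[0,\infty)\times\mathbb R$ is a function $\mathbf V\in C^r(U;\mathbb R^2)$ (up to $t=0$) which satisfies (P) on $U$. For $0<T\le\infty$ we say that the solution is smooth along its characteristics up to $T$ if there is a $C^r$ solution on some relatively open $U$ containing all points $(t,X(t,x_0))$, $x_0\in\mathbb R$, $0\le t<T$, and that it is smooth on the strip up to $T$ if there is a $C^r$ solution on $[0,T)\times\mathbb R$. 1. For every $x_0$ each of (S1), (S2) has exactly one solution on $[0,\infty)$. If $\mathbf V$ is a $C^r$ solution on $U$ and $0<\tau\le\infty$, then the characteristic of $\mathbf V$ from $x_0$ (that is, $\dot\xi=V_1(t,\xi)$, $\xi(0)=x_0$) exists in $U$ for $0\le t<\tau$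 if and only if $(t,X(t,x_0))\in U$ for $0\le t<\tau$. In this case it is $\xi(t)=X(t,x_0)$, and for $0\le t<\tau$: $\mathbf V(t,\xi(t))=\bar{\mathbf V}(t)$, $q(t)>0$ and $\mathbf V_x(t,\xi(t))=A^{-1}\left(\frac{u_1(t)}{q(t)},\frac{u_2(t)}{q(t)}\right)^T$. 2. The solution is smooth along its characteristics for all $t\ge 0$ if and only if for every $x_0\in\mathbb R$ the decisive function does not vanish for $t>0$. It is smooth on $[0,\infty)\times\mathbb R$ if and only if, in addition, $x_0\mapsto X(t,x_0)$ maps onto $\mathbb R$ for every $t\ge0$. The additional condition may be dropped if $V^0(x)=o(|x|)$ as $|x|\to\infty$ (in particular, for bounded data). 3. If $q(t_*,x_0)=0$ for some $x_0\in\mathbb R$ and some $t_*>0$, then $T_*<\infty$, and the solution has a singularity in finite time, exactly at $T_*$. That is, for every $0<T\le\infty$ the solution is smooth along its characteristics up to $T$ if and only if $T\le T_*$; it is smooth on the strip up to $T$ if and only if, in addition, $x_0\mapsto X(t,x_0)$ maps onto $\mathbb R$ for every $0\le t<T$, and this last condition may be dropped if $V^0(x)=o(|x|)$. Moreover, if $t_1>0$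 is the first zero of $q(\cdot,x_0)$ and $\mathbf V$ is a $C^r$ solution near the curve $(t,X(t,x_0))$, $0\le t<t_1$, then $(V_1)_x(t,X(t,x_0))\to-\infty$ as $t\uparrow t_1$; and if $0<T_*<\infty$ and the solution is smooth along its characteristics up to $T_*$, then $\sup_{x_0}|\mathbf V_x(t,X(t,x_0))|\to\infty$ as $t\uparrow T_*$. -/

import Mathlib

open Set Filter Topology Matrix Asymptotics

noncomputable section

namespace QuasilinearPair

/-- The closed half-plane `t ≥ 0` of points `(t, x)`. -/
def halfPlane : Set (ℝ × ℝ) := {p | 0 ≤ p.1}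

/-- Relatively open subsets of the half-plane `t ≥ 0`. -/
def IsRelOpen (U : Set (ℝ × ℝ)) : Prop := ∃ O : Set (ℝ × ℝ), IsOpen O ∧ U = O ∩ halfPlane

/-- The strip `[0, T) × ℝ`, where `T = ⊤` gives the whole half-plane. -/
def strip (T : EReal) : Set (ℝ × ℝ) := {p | 0 ≤ p.1 ∧ (p.1 : EReal) < T}

/-- The partial derivative `∂V/∂x` at the point `p = (t, x)`. -/
def spaceDeriv (V : ℝ × ℝ → Fin 2 → ℝ) (p : ℝ × ℝ) : Fin 2 → ℝ :=
  deriv (fun x => V (p.1, x)) p.2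

/-- The partial derivative `∂V/∂t` at the point `p = (t, x)`, one-sided on the line `t = 0`. -/
def timeDeriv (V : ℝ × ℝ → Fin 2 → ℝ) (p : ℝ × ℝ) : Fin 2 → ℝ :=
  derivWithin (fun t => V (t, p.2)) (Ici 0) p.1

/-- `V` is a solution of class `C^r` (up to `t = 0`), on the relatively open subset `U` of the
half-plane, of the Cauchy problem `∂V/∂t + V₁ ∂V/∂x = Q V`, `V(0, x) = V₀(x)`.
For `Q = !![-γ, k; N, 0]` and `V = (V, E)` this is the transformed Euler–Poisson system
`V_t + V V_x = k E - γ V`, `E_t + V E_x = N V`. -/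
structure IsSolutionOn (Q : Matrix (Fin 2) (Fin 2) ℝ) (V₀ : ℝ → Fin 2 → ℝ) (r : ℕ)
    (U : Set (ℝ × ℝ)) (V : ℝ × ℝ → Fin 2 → ℝ) : Prop where
  isRelOpen : IsRelOpen U
  contDiffOn : ContDiffOn ℝ r V U
  pde : ∀ p ∈ U, timeDeriv V p + V p 0 • spaceDeriv V p = Q *ᵥ V p
  init : ∀ x, ((0 : ℝ), x) ∈ U → V (0, x) = V₀ x

/-- `ξ` is, for `0 ≤ t < τ`, a characteristic of `V` in `U` starting at `x₀`:
`ξ' = V₁(t, ξ)`, `ξ(0) = x₀`. -/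
def IsCharacteristic (U : Set (ℝ × ℝ)) (V : ℝ × ℝ → Fin 2 → ℝ) (x₀ : ℝ) (τ : EReal)
    (ξ : ℝ → ℝ) : Prop :=
  ξ 0 = x₀ ∧ ∀ t : ℝ, 0 ≤ t → (t : EReal) < τ →
    (t, ξ t) ∈ U ∧ HasDerivWithinAt ξ (V (t, ξ t) 0) (Ici 0) t

/-- The linear system along characteristics for `t ≥ 0`:
`dV/dt = Q V`, `dx/dt = V₁`, `V(0) = V₀(x₀)`, `x(0) = x₀`. -/
structure SolvesCharSystem (Q : Matrix (Fin 2) (Fin 2) ℝ) (V₀ : ℝ → Fin 2 → ℝ) (x₀ : ℝ)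
    (v : ℝ → Fin 2 → ℝ) (x : ℝ → ℝ) : Prop where
  init_value : v 0 = V₀ x₀
  init_pos : x 0 = x₀
  deriv_value : ∀ t, 0 ≤ t → HasDerivWithinAt v (Q *ᵥ v t) (Ici 0) t
  deriv_pos : ∀ t, 0 ≤ t → HasDerivWithinAt x (v t 0) (Ici 0) t

/-- The value of the solution carried by the characteristic starting at `x₀`. -/
def charValue (Q : Matrix (Fin 2) (Fin 2) ℝ) (V₀ : ℝ → Fin 2 → ℝ) (x₀ t : ℝ) : Fin 2 → ℝ :=
  NormedSpace.exp (t • Q) *ᵥ V₀ x₀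

/-- The position at time `t` of the characteristic starting at `x₀`. -/
def charPos (Q : Matrix (Fin 2) (Fin 2) ℝ) (V₀ : ℝ → Fin 2 → ℝ) (x₀ t : ℝ) : ℝ :=
  x₀ + ∫ s in (0 : ℝ)..t, charValue Q V₀ x₀ s 0

/-- The matrix of the linear system for `(q, u₁, u₂)`, where `J = A Q A⁻¹`. -/
def radonMatrix (Q A : Matrix (Fin 2) (Fin 2) ℝ) : Matrix (Fin 3) (Fin 3) ℝ :=
  let J := A * Q * A⁻¹
  !![0, A 1 1 / A.det, -(A 0 1 / A.det);
     0, J 0 0, J 0 1;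
     0, J 1 0, J 1 1]

/-- The initial vector `(1, w₁, w₂)`, where `w = A V₀'(x₀)`. -/
def radonInit (A : Matrix (Fin 2) (Fin 2) ℝ) (V₀ : ℝ → Fin 2 → ℝ) (x₀ : ℝ) : Fin 3 → ℝ :=
  ![1, (A *ᵥ deriv V₀ x₀) 0, (A *ᵥ deriv V₀ x₀) 1]

/-- `y = (q, u₁, u₂)` solves the linear system `y' = radonMatrix · y` for `t ≥ 0`, with the
initial vector belonging to `x₀`. -/
structure SolvesRadonSystem (Q A : Matrix (Fin 2) (Fin 2) ℝ) (V₀ : ℝ → Fin 2 → ℝ) (x₀ : ℝ)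
    (y : ℝ → Fin 3 → ℝ) : Prop where
  init : y 0 = radonInit A V₀ x₀
  deriv : ∀ t, 0 ≤ t → HasDerivWithinAt y (radonMatrix Q A *ᵥ y t) (Ici 0) t

/-- The solution `(q, u₁, u₂)` of that system. -/
def radonSol (Q A : Matrix (Fin 2) (Fin 2) ℝ) (V₀ : ℝ → Fin 2 → ℝ) (x₀ t : ℝ) : Fin 3 → ℝ :=
  NormedSpace.exp (t • radonMatrix Q A) *ᵥ radonInit A V₀ x₀

/-- The decisive function `q(t)` belonging to `x₀`. -/
def decisive (Q A : Matrix (Fin 2) (Fin 2) ℝ) (V₀ : ℝ → Fin 2 → ℝ) (x₀ t : ℝ) : ℝ :=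
  radonSol Q A V₀ x₀ t 0

/-- The vector `w(t) = (u₁ / q, u₂ / q)` belonging to `x₀`. -/
def radonQuotient (Q A : Matrix (Fin 2) (Fin 2) ℝ) (V₀ : ℝ → Fin 2 → ℝ) (x₀ t : ℝ) :
    Fin 2 → ℝ :=
  ![radonSol Q A V₀ x₀ t 1 / decisive Q A V₀ x₀ t,
    radonSol Q A V₀ x₀ t 2 / decisive Q A V₀ x₀ t]

/-- The set swept out by all the characteristics for `0 ≤ t < T`. -/
def swept (Q : Matrix (Fin 2) (Fin 2) ℝ) (V₀ : ℝ → Fin 2 → ℝ) (T : EReal) : Set (ℝ × ℝ) :=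
  {p | ∃ x₀ t : ℝ, 0 ≤ t ∧ (t : EReal) < T ∧ p = (t, charPos Q V₀ x₀ t)}

/-- The Cauchy problem has a `C^r` solution along all its characteristics for `0 ≤ t < T`. -/
def SmoothOnSwept (Q : Matrix (Fin 2) (Fin 2) ℝ) (V₀ : ℝ → Fin 2 → ℝ) (r : ℕ) (T : EReal) :
    Prop :=
  ∃ U V, IsSolutionOn Q V₀ r U V ∧ swept Q V₀ T ⊆ U

/-- The Cauchy problem has a `C^r` solution on `[0, T) × ℝ`. -/
def SmoothOnStrip (Q : Matrix (Fin 2) (Fin 2) ℝ) (V₀ : ℝ → Fin 2 → ℝ) (r : ℕ) (T : EReal) :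
    Prop :=
  ∃ V, IsSolutionOn Q V₀ r (strip T) V

/-- `T_*`, the infimum over all `x₀` of the positive zeros of the decisive function
(`⊤` if there are none). -/
def blowupTime (Q A : Matrix (Fin 2) (Fin 2) ℝ) (V₀ : ℝ → Fin 2 → ℝ) : EReal :=
  sInf {T : EReal | ∃ x₀ t : ℝ, 0 < t ∧ decisive Q A V₀ x₀ t = 0 ∧ T = (t : EReal)}

end QuasilinearPair

end

noncomputable section

namespace QuasilinearPair

/-! Along a characteristic the equation reads V' = QV, so V = exp(tQ) V₀(x₀) and X(t, x₀) = x₀ +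
b(t) · V₀(x₀), with b(t) = `flowIntegral Q t`. The characteristics are thus explicit before any
solution is known. The change of unknowns by `A` in the system for (q, u₁, u₂) hides that q = 1 +
b(t) · V₀'(x₀) = ∂X/∂x₀ (`decisive_eq`): the decisive function is the Jacobian of (t, x₀) ↦ (t, X(t,
x₀)).

Differentiating V(t, X(t, x₀)) = exp(tQ) V₀(x₀) in x₀ gives q V_x = exp(tQ) V₀'(x₀)
(`decisive_smul_spaceDeriv`). A zero of q inside the domain of a solution would force V₀'(x₀) = 0
and hence q = 1, so q cannot vanish there. Conversely, if q > 0 for all x₀ and all t < T, the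
characteristic map is an injective local diffeomorphism, and transporting the values along it gives
a C² solution on the swept set (`isSolutionOn_swept`). This set is the strip exactly when every X(t,
·) is onto; on a strip, tracing characteristics back proves that this is necessary.

For the blow-up, (V₁)_x = q'/q is the logarithmic derivative of an analytic function, with limit -∞
to the left of a zero. The infimum T_* need not be attained, so there a quantitative bound is used:
|V_x| ≤ M at one point keeps q away from zero for a time depending only on M and Q
(`decisive_ne_zero_of_norm_le`). -/

theorem norm_mulVec_le {n : Type*} [Fintype n] (M : Matrix n n ℝ) : ∃ K, 0 ≤ K ∧ ∀ v : n → ℝ, ‖M *ᵥ v‖ ≤ K * ‖v‖ :=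
  ⟨_, norm_nonneg _, (LinearMap.toContinuousLinearMap (Matrix.mulVecLin M)).le_opNorm⟩

/-! ### Linear systems and the matrix exponential -/

section LinearSystems

variable {n : Type*} [Fintype n] [DecidableEq n]

theorem hasDerivAt_exp_smul_mulVec (M : Matrix n n ℝ) (v : n → ℝ) (t : ℝ) :
    HasDerivAt (fun s : ℝ => NormedSpace.exp (s • M) *ᵥ v)
      (M *ᵥ (NormedSpace.exp (t • M) *ᵥ v)) t := by
  let _ : NormedRing (Matrix n n ℝ) := Matrix.linftyOpNormedRing
  let _ : NormedAlgebra ℝ (Matrix n n ℝ) := Matrix.linftyOpNormedAlgebra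
  have h := hasDerivAt_exp_smul_const' (𝕂 := ℝ) M t
  have hL := (LinearMap.toContinuousLinearMap
    ((Matrix.mulVecBilin ℝ ℝ).flip v : Matrix n n ℝ →ₗ[ℝ] n → ℝ)).hasFDerivAt.comp_hasDerivAt t h
  rw [Matrix.mulVec_mulVec]
  exact hL

theorem analyticAt_exp_smul_apply (M : Matrix n n ℝ) (i j : n) (t : ℝ) :
    AnalyticAt ℝ (fun s : ℝ => NormedSpace.exp (s • M) i j) t := by
  let _ : NormedRing (Matrix n n ℝ) := Matrix.linftyOpNormedRing
  let _ : NormedAlgebra ℝ (Matrix n n ℝ) := Matrix.linftyOpNormedAlgebra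
  have h : AnalyticAt ℝ (fun s : ℝ => NormedSpace.exp (s • M)) t :=
    (NormedSpace.exp_analytic (𝕂 := ℝ) (t • M)).comp_of_eq
      (analyticAt_id.smul analyticAt_const) rfl
  exact ((LinearMap.toContinuousLinearMap
    (Matrix.entryLinearMap ℝ ℝ i j)).analyticAt _).comp h

theorem analyticAt_exp_smul_mulVec_apply (M : Matrix n n ℝ) (v : n → ℝ) (i : n) (t : ℝ) :
    AnalyticAt ℝ (fun s : ℝ => (NormedSpace.exp (s • M) *ᵥ v) i) t := by
  simp only [Matrix.mulVec, dotProduct]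
  exact Finset.analyticAt_fun_sum _ fun j _ =>
    (analyticAt_exp_smul_apply M i j t).mul analyticAt_const

/-- Solutions of a linear system on `[0, ∞)` are given by the matrix exponential. -/
theorem eqOn_exp_smul_mulVec {M : Matrix n n ℝ} {y : ℝ → n → ℝ}
    (hy : ∀ t, 0 ≤ t → HasDerivWithinAt y (M *ᵥ y t) (Ici 0) t) :
    EqOn y (fun t => NormedSpace.exp (t • M) *ᵥ y 0) (Ici 0) := by
  intro t ht
  obtain ⟨K, -, hK⟩ := norm_mulVec_le M
  have hd : ∀ s, 0 ≤ s → HasDerivWithinAt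
      (fun s => y s - NormedSpace.exp (s • M) *ᵥ y 0)
      (M *ᵥ (y s - NormedSpace.exp (s • M) *ᵥ y 0)) (Ici 0) s := fun s hs => by
    rw [Matrix.mulVec_sub]
    exact (hy s hs).sub (hasDerivAt_exp_smul_mulVec M (y 0) s).hasDerivWithinAt
  have h := eq_zero_of_abs_deriv_le_mul_abs_self_of_eq_zero_right (a := 0) (b := t) (K := K)
    (f := fun s => y s - NormedSpace.exp (s • M) *ᵥ y 0)
    (fun s hs => (hd s hs.1).continuousWithinAt.mono fun r hr => hr.1)
    (fun s hs => (hd s hs.1).mono (Ici_subset_Ici.2 hs.1)) (by simp)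
    (fun s _ => hK _) t ⟨ht, le_rfl⟩
  exact sub_eq_zero.1 h

/-- A function on `[0, τ)` is determined by its derivative and its initial value. -/
theorem eq_of_hasDerivWithinAt_Ici {f g f' : ℝ → ℝ} {τ : EReal} (h0 : f 0 = g 0)
    (hf : ∀ t : ℝ, 0 ≤ t → (t : EReal) < τ → HasDerivWithinAt f (f' t) (Ici 0) t)
    (hg : ∀ t : ℝ, 0 ≤ t → (t : EReal) < τ → HasDerivWithinAt g (f' t) (Ici 0) t)
    {t : ℝ} (ht : 0 ≤ t) (htτ : (t : EReal) < τ) : f t = g t := by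
  have hlt : ∀ s ≤ t, (s : EReal) < τ := fun s hs => (EReal.coe_le_coe_iff.2 hs).trans_lt htτ
  exact eq_of_has_deriv_right_eq (a := 0) (b := t) (f' := f')
    (fun s hs => (hf s hs.1 (hlt s hs.2.le)).mono (Ici_subset_Ici.2 hs.1))
    (fun s hs => (hg s hs.1 (hlt s hs.2.le)).mono (Ici_subset_Ici.2 hs.1))
    (fun s hs => (hf s hs.1 (hlt s hs.2)).continuousWithinAt.mono fun r hr => hr.1)
    (fun s hs => (hg s hs.1 (hlt s hs.2)).continuousWithinAt.mono fun r hr => hr.1) h0 t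
    ⟨ht, le_rfl⟩

end LinearSystems

/-! ### Explicit formulas for the characteristics and the decisive function -/

section Formulas

theorem mulVec_two (M : Matrix (Fin 2) (Fin 2) ℝ) (v : Fin 2 → ℝ) (i : Fin 2) :
    (M *ᵥ v) i = M i 0 * v 0 + M i 1 * v 1 := by
  simp [Matrix.mulVec, dotProduct, Fin.sum_univ_two]

theorem mulVec_three (M : Matrix (Fin 3) (Fin 3) ℝ) (v : Fin 3 → ℝ) (i : Fin 3) :
    (M *ᵥ v) i = M i 0 * v 0 + M i 1 * v 1 + M i 2 * v 2 := by
  simp [Matrix.mulVec, dotProduct, Fin.sum_univ_three]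

variable (Q A : Matrix (Fin 2) (Fin 2) ℝ) (V₀ : ℝ → Fin 2 → ℝ) (x₀ t : ℝ)

/-- The first row of `∫₀ᵗ exp (s Q) ds`. -/
def flowIntegral : Fin 2 → ℝ := fun j => ∫ s in (0 : ℝ)..t, NormedSpace.exp (s • Q) 0 j

theorem hasDerivAt_charValue :
    HasDerivAt (charValue Q V₀ x₀) (Q *ᵥ charValue Q V₀ x₀ t) t :=
  hasDerivAt_exp_smul_mulVec Q (V₀ x₀) t

@[simp] theorem charValue_zero : charValue Q V₀ x₀ 0 = V₀ x₀ := by simp [charValue]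

@[simp] theorem flowIntegral_zero : flowIntegral Q 0 = 0 := by
  funext j; simp [flowIntegral]

theorem continuous_exp_smul_apply (i j : Fin 2) :
    Continuous fun s : ℝ => NormedSpace.exp (s • Q) i j :=
  continuous_iff_continuousAt.2 fun s => (analyticAt_exp_smul_apply Q i j s).continuousAt

theorem hasDerivAt_flowIntegral (j : Fin 2) :
    HasDerivAt (fun s => flowIntegral Q s j) (NormedSpace.exp (t • Q) 0 j) t :=
  (continuous_exp_smul_apply Q 0 j).integral_hasStrictDerivAt 0 t |>.hasDerivAt

theorem contDiff_exp_smul_apply (i j : Fin 2) {m : WithTop ℕ∞} :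
    ContDiff ℝ m fun s : ℝ => NormedSpace.exp (s • Q) i j :=
  contDiff_iff_contDiffAt.2 fun s => (analyticAt_exp_smul_apply Q i j s).contDiffAt

theorem contDiff_flowIntegral (j : Fin 2) : ContDiff ℝ 2 fun s => flowIntegral Q s j := by
  rw [show (2 : WithTop ℕ∞) = 1 + 1 by norm_num, contDiff_succ_iff_deriv]
  refine ⟨fun s => (hasDerivAt_flowIntegral Q s j).differentiableAt, by simp, ?_⟩
  rw [funext fun s => (hasDerivAt_flowIntegral Q s j).deriv]
  exact contDiff_exp_smul_apply Q 0 j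

theorem hasDerivAt_flowIntegral_dotProduct (v : Fin 2 → ℝ) :
    HasDerivAt (fun s => flowIntegral Q s ⬝ᵥ v) ((NormedSpace.exp (t • Q) *ᵥ v) 0) t := by
  simp only [Matrix.mulVec, dotProduct, Fin.sum_univ_two]
  exact ((hasDerivAt_flowIntegral Q t 0).mul_const _).add
    ((hasDerivAt_flowIntegral Q t 1).mul_const _)

theorem charPos_eq : charPos Q V₀ x₀ t = x₀ + flowIntegral Q t ⬝ᵥ V₀ x₀ := by
  have hi : ∀ j, IntervalIntegrable (fun s : ℝ => NormedSpace.exp (s • Q) 0 j * V₀ x₀ j)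
      MeasureTheory.volume 0 t := fun j =>
    ((continuous_exp_smul_apply Q 0 j).mul continuous_const).intervalIntegrable _ _
  simp only [charPos, charValue, Matrix.mulVec, dotProduct, flowIntegral, Fin.sum_univ_two]
  rw [intervalIntegral.integral_add (hi 0) (hi 1), intervalIntegral.integral_mul_const,
    intervalIntegral.integral_mul_const]

theorem hasDerivAt_charPos : HasDerivAt (charPos Q V₀ x₀) (charValue Q V₀ x₀ t 0) t := by
  rw [funext (charPos_eq Q V₀ x₀)]
  exact (hasDerivAt_flowIntegral_dotProduct Q t (V₀ x₀)).const_add x₀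

@[simp] theorem charPos_zero : charPos Q V₀ x₀ 0 = x₀ := by simp [charPos]

theorem solvesCharSystem : SolvesCharSystem Q V₀ x₀ (charValue Q V₀ x₀) (charPos Q V₀ x₀) where
  init_value := charValue_zero Q V₀ x₀
  init_pos := charPos_zero Q V₀ x₀
  deriv_value t _ := (hasDerivAt_charValue Q V₀ x₀ t).hasDerivWithinAt
  deriv_pos t _ := (hasDerivAt_charPos Q V₀ x₀ t).hasDerivWithinAt

theorem solvesRadonSystem : SolvesRadonSystem Q A V₀ x₀ (radonSol Q A V₀ x₀) where
  init := by simp [radonSol]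
  deriv t _ := (hasDerivAt_exp_smul_mulVec _ _ t).hasDerivWithinAt

variable {Q A V₀ x₀ t}

theorem SolvesCharSystem.eqOn {v : ℝ → Fin 2 → ℝ} {x : ℝ → ℝ}
    (h : SolvesCharSystem Q V₀ x₀ v x) :
    EqOn v (charValue Q V₀ x₀) (Ici 0) ∧ EqOn x (charPos Q V₀ x₀) (Ici 0) := by
  have hv : EqOn v (charValue Q V₀ x₀) (Ici 0) := by
    have := eqOn_exp_smul_mulVec h.deriv_value
    rwa [h.init_value] at this
  refine ⟨hv, fun t ht => eq_of_hasDerivWithinAt_Ici (τ := ⊤) (f' := fun t => v t 0)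
    (by rw [h.init_pos, charPos_zero]) (fun s hs _ => h.deriv_pos s hs) (fun s hs _ => ?_)
    ht (EReal.coe_lt_top t)⟩
  rw [hv hs]
  exact (hasDerivAt_charPos Q V₀ x₀ s).hasDerivWithinAt

theorem SolvesRadonSystem.eqOn {y : ℝ → Fin 3 → ℝ} (h : SolvesRadonSystem Q A V₀ x₀ y) :
    EqOn y (radonSol Q A V₀ x₀) (Ici 0) := by
  have := eqOn_exp_smul_mulVec h.deriv
  rwa [h.init] at this

theorem inv_mulVec_mulVec (hA : IsUnit A.det) (v : Fin 2 → ℝ) : A⁻¹ *ᵥ (A *ᵥ v) = v := by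
  rw [Matrix.mulVec_mulVec, Matrix.nonsing_inv_mul A hA, Matrix.one_mulVec]

/-- The solution of the system for `(q, u₁, u₂)` in terms of `exp (t Q)`. -/
theorem solvesRadonSystem_flow (hA : IsUnit A.det) :
    SolvesRadonSystem Q A V₀ x₀ (fun t =>
      ![1 + flowIntegral Q t ⬝ᵥ deriv V₀ x₀,
        (A *ᵥ (NormedSpace.exp (t • Q) *ᵥ deriv V₀ x₀)) 0,
        (A *ᵥ (NormedSpace.exp (t • Q) *ᵥ deriv V₀ x₀)) 1]) where
  init := by simp [radonInit]
  deriv t _ := by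
    apply HasDerivAt.hasDerivWithinAt
    set w := fun s : ℝ => NormedSpace.exp (s • Q) *ᵥ deriv V₀ x₀ with hw
    have hwd : HasDerivAt w (Q *ᵥ w t) t := hasDerivAt_exp_smul_mulVec Q _ t
    have hu : ∀ i, HasDerivAt (fun s => (A *ᵥ w s) i) ((A *ᵥ (Q *ᵥ w t)) i) t := fun i =>
      hasDerivAt_pi.1 (((LinearMap.toContinuousLinearMap
        (Matrix.mulVecLin A)).hasFDerivAt (x := w t)).comp_hasDerivAt t hwd) i
    have h0 : (A⁻¹ *ᵥ (A *ᵥ w t)) 0 = w t 0 := by rw [inv_mulVec_mulVec hA]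
    have h1 : ∀ z, (A * Q * A⁻¹) *ᵥ (A *ᵥ z) = A *ᵥ (Q *ᵥ z) := fun z => by
      rw [← Matrix.mulVec_mulVec, inv_mulVec_mulVec hA, Matrix.mulVec_mulVec]
    have h10 := congrFun (h1 (w t)) 0
    have h11 := congrFun (h1 (w t)) 1
    -- The nonzero entries in the first row of `radonMatrix` form the first row of `A⁻¹`, so q' is
    -- the first component of A⁻¹u = exp(tQ) V₀'(x₀).
    have hdet : A⁻¹ 0 0 = A 1 1 / A.det ∧ A⁻¹ 0 1 = -(A 0 1 / A.det) := by
      rw [Matrix.inv_def, Matrix.adjugate_fin_two, Ring.inverse_eq_inv']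
      constructor <;> simp <;> ring
    simp only [mulVec_two] at h0
    rw [mulVec_two] at h10 h11
    rw [hdet.1, hdet.2] at h0
    rw [hasDerivAt_pi]
    intro i
    fin_cases i
    · refine ((hasDerivAt_flowIntegral_dotProduct Q t (deriv V₀ x₀)).const_add 1).congr_deriv ?_
      simp only [mulVec_two]
      simpa [radonMatrix, mulVec_three, hw, mulVec_two] using h0.symm
    · refine (hu 0).congr_deriv ?_
      rw [← h10]
      simp [radonMatrix, mulVec_three, hw]
    · refine (hu 1).congr_deriv ?_
      rw [← h11]
      simp [radonMatrix, mulVec_three, hw]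

theorem radonSol_eq (hA : IsUnit A.det) (ht : 0 ≤ t) :
    radonSol Q A V₀ x₀ t = ![1 + flowIntegral Q t ⬝ᵥ deriv V₀ x₀,
        (A *ᵥ (NormedSpace.exp (t • Q) *ᵥ deriv V₀ x₀)) 0,
        (A *ᵥ (NormedSpace.exp (t • Q) *ᵥ deriv V₀ x₀)) 1] :=
  ((solvesRadonSystem_flow hA).eqOn ht).symm

theorem decisive_eq (hA : IsUnit A.det) (ht : 0 ≤ t) :
    decisive Q A V₀ x₀ t = 1 + flowIntegral Q t ⬝ᵥ deriv V₀ x₀ := by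
  simp [decisive, radonSol_eq hA ht]

theorem inv_mulVec_radonQuotient (hA : IsUnit A.det) (ht : 0 ≤ t) :
    A⁻¹ *ᵥ radonQuotient Q A V₀ x₀ t =
      (decisive Q A V₀ x₀ t)⁻¹ • (NormedSpace.exp (t • Q) *ᵥ deriv V₀ x₀) := by
  have : radonQuotient Q A V₀ x₀ t =
      (decisive Q A V₀ x₀ t)⁻¹ • (A *ᵥ (NormedSpace.exp (t • Q) *ᵥ deriv V₀ x₀)) := by
    funext i
    fin_cases i <;> simp [radonQuotient, radonSol_eq hA ht, div_eq_inv_mul]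
  rw [this, Matrix.mulVec_smul, inv_mulVec_mulVec hA]

theorem analyticAt_decisive : AnalyticAt ℝ (decisive Q A V₀ x₀) t :=
  analyticAt_exp_smul_mulVec_apply (radonMatrix Q A) (radonInit A V₀ x₀) 0 t

@[simp] theorem decisive_zero : decisive Q A V₀ x₀ 0 = 1 := by
  simp [decisive, radonSol, radonInit]

theorem continuous_decisive : Continuous (decisive Q A V₀ x₀) :=
  continuous_iff_continuousAt.2 fun _ => analyticAt_decisive.continuousAt

/-- Before its first zero the decisive function is positive. -/
theorem decisive_pos {τ : EReal}
    (h : ∀ t : ℝ, 0 < t → (t : EReal) < τ → decisive Q A V₀ x₀ t ≠ 0)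
    (ht : 0 ≤ t) (htτ : (t : EReal) < τ) : 0 < decisive Q A V₀ x₀ t := by
  by_contra! hneg
  obtain ⟨s, hs, hs0⟩ := intermediate_value_Icc' ht
    (continuous_decisive (Q := Q) (A := A) (V₀ := V₀) (x₀ := x₀)).continuousOn
    (show (0 : ℝ) ∈ Icc _ _ from ⟨hneg, by simp⟩)
  refine h s (hs.1.lt_of_ne ?_) ((EReal.coe_le_coe_iff.2 hs.2).trans_lt htτ) hs0
  rintro rfl
  simp at hs0

end Formulas

/-! ### Gronwall uniqueness, forward and backward in time -/

section Gronwall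

variable {E : Type*} [NormedAddCommGroup E] [NormedSpace ℝ E]

theorem eq_zero_right_of_norm_deriv_le {W W' : ℝ → E} {K a b : ℝ}
    (hW : ∀ s ∈ Icc a b, HasDerivWithinAt W (W' s) (Icc a b) s)
    (hK : ∀ s ∈ Icc a b, ‖W' s‖ ≤ K * ‖W s‖) (h0 : W a = 0) : ∀ s ∈ Icc a b, W s = 0 :=
  eq_zero_of_abs_deriv_le_mul_abs_self_of_eq_zero_right
    (fun s hs => (hW s hs).continuousWithinAt)
    (fun s hs => (hW s (Ico_subset_Icc_self hs)).mono_of_mem_nhdsWithin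
      (Icc_mem_nhdsGE_of_mem hs)) h0 fun s hs => hK s (Ico_subset_Icc_self hs)

/-- Time reversal reduces this to the forward case. It is what allows a characteristic to be traced
back from an arbitrary point of the strip. -/
theorem eq_zero_left_of_norm_deriv_le {W W' : ℝ → E} {K a b : ℝ}
    (hW : ∀ s ∈ Icc a b, HasDerivWithinAt W (W' s) (Icc a b) s)
    (hK : ∀ s ∈ Icc a b, ‖W' s‖ ≤ K * ‖W s‖) (h0 : W b = 0) : ∀ s ∈ Icc a b, W s = 0 := by
  have hmaps : ∀ s ∈ Icc (-b) (-a), -s ∈ Icc a b := fun s hs =>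
    ⟨by linarith [hs.2], by linarith [hs.1]⟩
  have h := eq_zero_right_of_norm_deriv_le (W := fun s => W (-s)) (W' := fun s => -W' (-s))
    (K := K) (a := -b) (b := -a) (fun s hs => ?_) (fun s hs => ?_) (by simpa using h0)
  · intro s hs
    simpa using h (-s) ⟨by linarith [hs.2], by linarith [hs.1]⟩
  · have := (hW (-s) (hmaps s hs)).scomp s ((hasDerivAt_neg s).hasDerivWithinAt) hmaps
    simpa [Function.comp_def] using this
  · simpa using hK (-s) (hmaps s hs)

end Gronwall

/-! ### Arbitrary solutions along the characteristics -/

section Solutions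

variable {Q A : Matrix (Fin 2) (Fin 2) ℝ} {V₀ : ℝ → Fin 2 → ℝ} {r : ℕ} {U : Set (ℝ × ℝ)}
  {V : ℝ × ℝ → Fin 2 → ℝ} {p : ℝ × ℝ}

theorem IsRelOpen.subset (hU : IsRelOpen U) : U ⊆ halfPlane := by
  obtain ⟨O, -, rfl⟩ := hU
  exact inter_subset_right

theorem IsRelOpen.mem_nhdsWithin (hU : IsRelOpen U) (hp : p ∈ U) : U ∈ 𝓝[halfPlane] p := by
  obtain ⟨O, hO, rfl⟩ := hU
  exact inter_mem (mem_nhdsWithin_of_mem_nhds (hO.mem_nhds hp.1)) self_mem_nhdsWithin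

theorem uniqueDiffOn_halfPlane : UniqueDiffOn ℝ halfPlane := by
  have : halfPlane = Ici (0 : ℝ) ×ˢ (univ : Set ℝ) := by ext p; simp [halfPlane]
  rw [this]
  exact (uniqueDiffOn_Ici 0).prod uniqueDiffOn_univ

theorem IsRelOpen.uniqueDiffOn (hU : IsRelOpen U) : UniqueDiffOn ℝ U := by
  obtain ⟨O, hO, rfl⟩ := hU
  rw [inter_comm]
  exact uniqueDiffOn_halfPlane.inter hO

section Derivatives

variable {V' : ℝ × ℝ →L[ℝ] Fin 2 → ℝ}

/-- The chain rule along curves `s ↦ (s, γ s)` in the half-plane. -/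
theorem hasDerivWithinAt_along (h : HasFDerivWithinAt V V' halfPlane p) {γ : ℝ → ℝ} {γ' : ℝ}
    {S : Set ℝ} (hS : S ⊆ Ici 0) (hp : p = (p.1, γ p.1))
    (hγ : HasDerivWithinAt γ γ' S p.1) :
    HasDerivWithinAt (fun s => V (s, γ s)) (V' (1, 0) + γ' • V' (0, 1)) S p.1 := by
  have h2 : HasDerivWithinAt (fun s => (s, γ s)) ((1 : ℝ), γ') S p.1 :=
    (hasDerivWithinAt_id _ _).prodMk hγ
  have h3 := HasFDerivWithinAt.comp_hasDerivWithinAt_of_eq p.1 h h2 (fun s hs => hS hs) hp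
  refine h3.congr_deriv ?_
  rw [← map_smul, ← map_add]
  simp

theorem hasDerivAt_space (h : HasFDerivWithinAt V V' halfPlane p) (hp : 0 ≤ p.1) :
    HasDerivAt (fun x => V (p.1, x)) (V' (0, 1)) p.2 := by
  have h2 : HasDerivWithinAt (fun x : ℝ => (p.1, x)) ((0 : ℝ), (1 : ℝ)) univ p.2 :=
    (hasDerivWithinAt_const _ _ _).prodMk (hasDerivWithinAt_id _ _)
  exact hasDerivWithinAt_univ.1
    (HasFDerivWithinAt.comp_hasDerivWithinAt_of_eq p.2 h h2 (fun s _ => hp) rfl)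

theorem spaceDeriv_eq (h : HasFDerivWithinAt V V' halfPlane p) (hp : 0 ≤ p.1) :
    spaceDeriv V p = V' (0, 1) :=
  (hasDerivAt_space h hp).deriv

theorem timeDeriv_eq (h : HasFDerivWithinAt V V' halfPlane p) (hp : 0 ≤ p.1) :
    timeDeriv V p = V' (1, 0) := by
  have := hasDerivWithinAt_along h (γ := fun _ => p.2) (γ' := 0) (S := Ici 0) subset_rfl rfl
    (hasDerivWithinAt_const _ _ _)
  rw [zero_smul, add_zero] at this
  exact this.derivWithin (uniqueDiffOn_Ici 0 _ hp)

end Derivatives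

variable (hV : IsSolutionOn Q V₀ r U V) (hr : 1 ≤ r)

namespace IsSolutionOn

include hV

theorem nonneg (hp : p ∈ U) : 0 ≤ p.1 := hV.isRelOpen.subset hp

include hr

theorem hasFDerivWithinAt (hp : p ∈ U) :
    HasFDerivWithinAt V (fderivWithin ℝ V U p) halfPlane p :=
  ((hV.contDiffOn.differentiableOn (by exact_mod_cast (by omega : r ≠ 0))) p
    hp).hasFDerivWithinAt.mono_of_mem_nhdsWithin (hV.isRelOpen.mem_nhdsWithin hp)

theorem hasDerivAt_spaceDeriv (hp : p ∈ U) :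
    HasDerivAt (fun x => V (p.1, x)) (spaceDeriv V p) p.2 := by
  have h := hV.hasFDerivWithinAt hr hp
  rw [spaceDeriv_eq h (hV.nonneg hp)]
  exact hasDerivAt_space h (hV.nonneg hp)

theorem continuousOn_spaceDeriv : ContinuousOn (spaceDeriv V) U := by
  have h := hV.contDiffOn.continuousOn_fderivWithin hV.isRelOpen.uniqueDiffOn
    (by exact_mod_cast hr)
  refine (h.clm_apply (continuousOn_const (c := ((0 : ℝ), (1 : ℝ))))).congr fun p hp => ?_
  exact spaceDeriv_eq (hV.hasFDerivWithinAt hr hp) (hV.nonneg hp)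

/-- The derivative of a solution along an arbitrary curve. -/
theorem hasDerivWithinAt_along {γ : ℝ → ℝ} {γ' s : ℝ} {S : Set ℝ} (hS : S ⊆ Ici 0)
    (hs : (s, γ s) ∈ U) (hγ : HasDerivWithinAt γ γ' S s) :
    HasDerivWithinAt (fun s => V (s, γ s))
      (Q *ᵥ V (s, γ s) + (γ' - V (s, γ s) 0) • spaceDeriv V (s, γ s)) S s := by
  have h := hV.hasFDerivWithinAt hr hs
  refine (QuasilinearPair.hasDerivWithinAt_along h hS rfl hγ).congr_deriv ?_
  rw [← hV.pde _ hs, spaceDeriv_eq h (hV.nonneg hs), timeDeriv_eq h (hV.nonneg hs)]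
  module

/-- If a curve `γ` moves with the velocity `c₁` of a solution `c` of `c' = Q c`, and `V = c` at
one end of `γ`, then `V = c` along `γ`. -/
theorem eq_along {c : ℝ → Fin 2 → ℝ} {γ : ℝ → ℝ} {a b : ℝ} (ha : 0 ≤ a)
    (hc : ∀ s, HasDerivAt c (Q *ᵥ c s) s) (hγ : ∀ s, HasDerivAt γ (c s 0) s)
    (hU : ∀ s ∈ Icc a b, (s, γ s) ∈ U) (h0 : V (a, γ a) = c a ∨ V (b, γ b) = c b) :
    ∀ s ∈ Icc a b, V (s, γ s) = c s := by
  obtain ⟨K, hK0, hK⟩ := norm_mulVec_le Q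
  have hcont : ContinuousOn (fun s => spaceDeriv V (s, γ s)) (Icc a b) :=
    (hV.continuousOn_spaceDeriv hr).comp
      (continuous_id.prodMk (continuous_iff_continuousAt.2
        fun s => (hγ s).continuousAt)).continuousOn hU
  obtain ⟨C, hC⟩ := isCompact_Icc.exists_bound_of_continuousOn hcont
  -- The difference W = V - c satisfies W' = QW - W₁ V_x. As V_x is bounded on the compact curve,
  -- |W'| is at most a constant times |W|.
  have hd : ∀ s ∈ Icc a b, HasDerivWithinAt (fun s => V (s, γ s) - c s)
      (Q *ᵥ (V (s, γ s) - c s) - (V (s, γ s) - c s) 0 • spaceDeriv V (s, γ s)) (Icc a b) s := by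
    intro s hs
    refine ((hV.hasDerivWithinAt_along hr (fun t ht => ha.trans ht.1) (hU s hs)
      (hγ s).hasDerivWithinAt).sub (hc s).hasDerivWithinAt).congr_deriv ?_
    rw [Matrix.mulVec_sub, Pi.sub_apply]
    module
  have hb : ∀ s ∈ Icc a b, ‖Q *ᵥ (V (s, γ s) - c s) -
      (V (s, γ s) - c s) 0 • spaceDeriv V (s, γ s)‖ ≤ (K + C) * ‖V (s, γ s) - c s‖ := by
    intro s hs
    refine (norm_sub_le _ _).trans ?_
    rw [norm_smul, add_mul, mul_comm C]
    exact add_le_add (hK _) (mul_le_mul (norm_le_pi_norm _ 0) (hC s hs) (norm_nonneg _)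
      (norm_nonneg _))
  intro s hs
  refine sub_eq_zero.1 ?_
  rcases h0 with h0 | h0
  · exact eq_zero_right_of_norm_deriv_le hd hb (sub_eq_zero.2 h0) s hs
  · exact eq_zero_left_of_norm_deriv_le hd hb (sub_eq_zero.2 h0) s hs

theorem eq_charValue {x₀ t : ℝ} (ht : 0 ≤ t)
    (hU : ∀ s ∈ Icc 0 t, (s, charPos Q V₀ x₀ s) ∈ U) :
    V (t, charPos Q V₀ x₀ t) = charValue Q V₀ x₀ t := by
  refine hV.eq_along hr le_rfl (hasDerivAt_charValue Q V₀ x₀) (hasDerivAt_charPos Q V₀ x₀) hU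
    (.inl ?_) t ⟨ht, le_rfl⟩
  have h0 := hU 0 ⟨le_rfl, ht⟩
  rw [charPos_zero] at h0 ⊢
  rw [hV.init _ h0, charValue_zero]

end IsSolutionOn

theorem eventually_coe_lt {τ : EReal} {t : ℝ} (h : (t : EReal) < τ) :
    ∀ᶠ s : ℝ in 𝓝 t, (s : EReal) < τ :=
  continuous_coe_real_ereal.continuousAt.eventually_lt_const h

include hV hr in
-- On a characteristic of `V` the term with V_x drops out, so V solves the linear system there and
-- the curve moves with the speed of X. Conversely, V takes the values `charValue` along X by
-- `eq_charValue`, so X has the speed V₁.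
theorem isCharacteristic_iff {x₀ : ℝ} {τ : EReal} (hτ : 0 < τ) (ξ : ℝ → ℝ) :
    IsCharacteristic U V x₀ τ ξ ↔ ∀ t : ℝ, 0 ≤ t → (t : EReal) < τ →
      ξ t = charPos Q V₀ x₀ t ∧ (t, charPos Q V₀ x₀ t) ∈ U := by
  constructor
  · rintro ⟨h0, h⟩
    have hval : ∀ t : ℝ, 0 ≤ t → (t : EReal) < τ → V (t, ξ t) = charValue Q V₀ x₀ t := by
      intro t ht htτ
      have hlt : ∀ s ≤ t, (s : EReal) < τ := fun s hs =>
        (EReal.coe_le_coe_iff.2 hs).trans_lt htτ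
      obtain ⟨K, -, hK⟩ := norm_mulVec_le Q
      have hd : ∀ s ∈ Icc 0 t, HasDerivWithinAt (fun s => V (s, ξ s) - charValue Q V₀ x₀ s)
          (Q *ᵥ (V (s, ξ s) - charValue Q V₀ x₀ s)) (Icc 0 t) s := by
        intro s hs
        obtain ⟨hsU, hsξ⟩ := h s hs.1 (hlt s hs.2)
        have := hV.hasDerivWithinAt_along hr Icc_subset_Ici_self hsU
          (hsξ.mono (Icc_subset_Ici_self : Icc 0 t ⊆ Ici 0))
        refine (this.sub (hasDerivAt_charValue Q V₀ x₀ s).hasDerivWithinAt).congr_deriv ?_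
        rw [Matrix.mulVec_sub, sub_self, zero_smul, add_zero]
      refine sub_eq_zero.1 (eq_zero_right_of_norm_deriv_le hd (fun s _ => hK _) ?_ t
        ⟨ht, le_rfl⟩)
      have h0U := (h 0 le_rfl (hlt 0 ht)).1
      rw [h0] at h0U ⊢
      rw [hV.init _ h0U, charValue_zero, sub_self]
    have heq : ∀ t : ℝ, 0 ≤ t → (t : EReal) < τ → ξ t = charPos Q V₀ x₀ t := by
      intro t ht htτ
      refine eq_of_hasDerivWithinAt_Ici (f' := fun t => charValue Q V₀ x₀ t 0)
        (by rw [h0, charPos_zero]) (fun s hs hsτ => ?_)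
        (fun s _ _ => (hasDerivAt_charPos Q V₀ x₀ s).hasDerivWithinAt) ht htτ
      rw [← hval s hs hsτ]
      exact (h s hs hsτ).2
    intro t ht htτ
    refine ⟨heq t ht htτ, ?_⟩
    rw [← heq t ht htτ]
    exact (h t ht htτ).1
  · intro h
    refine ⟨by rw [(h 0 le_rfl hτ).1, charPos_zero], fun t ht htτ => ?_⟩
    obtain ⟨hξ, hU⟩ := h t ht htτ
    rw [hξ]
    refine ⟨hU, ?_⟩
    rw [hV.eq_charValue hr ht fun s hs =>
      (h s hs.1 ((EReal.coe_le_coe_iff.2 hs.2).trans_lt htτ)).2]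
    refine (hasDerivAt_charPos Q V₀ x₀ t).hasDerivWithinAt.congr_of_eventuallyEq ?_ hξ
    filter_upwards [self_mem_nhdsWithin, mem_nhdsWithin_of_mem_nhds (eventually_coe_lt htτ)]
      with s hs hsτ
    exact (h s hs hsτ).1

theorem hasDerivAt_dotProduct_comp (w : Fin 2 → ℝ) {x₀ : ℝ}
    (hV₀ : DifferentiableAt ℝ V₀ x₀) :
    HasDerivAt (fun y => w ⬝ᵥ V₀ y) (w ⬝ᵥ deriv V₀ x₀) x₀ := by
  have h := hasDerivAt_pi.1 hV₀.hasDerivAt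
  simp only [dotProduct, Fin.sum_univ_two]
  exact ((h 0).const_mul _).add ((h 1).const_mul _)

theorem hasDerivAt_charPos_space (t : ℝ) {x₀ : ℝ} (hV₀ : DifferentiableAt ℝ V₀ x₀) :
    HasDerivAt (fun y => charPos Q V₀ y t) (1 + flowIntegral Q t ⬝ᵥ deriv V₀ x₀) x₀ := by
  simp only [charPos_eq]
  exact (hasDerivAt_id x₀).add (hasDerivAt_dotProduct_comp _ hV₀)

theorem hasDerivAt_charValue_space (t : ℝ) {x₀ : ℝ} (hV₀ : DifferentiableAt ℝ V₀ x₀) :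
    HasDerivAt (fun y => charValue Q V₀ y t) (NormedSpace.exp (t • Q) *ᵥ deriv V₀ x₀) x₀ :=
  hasDerivAt_pi.2 fun _ => hasDerivAt_dotProduct_comp _ hV₀

theorem contDiff_charPos (hV₀ : ContDiff ℝ 2 V₀) :
    ContDiff ℝ 2 fun p : ℝ × ℝ => charPos Q V₀ p.2 p.1 := by
  simp only [charPos_eq, dotProduct]
  exact contDiff_snd.add (ContDiff.sum fun j _ =>
    ((contDiff_flowIntegral Q j).comp contDiff_fst).mul
      (((contDiff_pi.1 hV₀) j).comp contDiff_snd))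

theorem contDiff_charValue (hV₀ : ContDiff ℝ 2 V₀) :
    ContDiff ℝ 2 fun p : ℝ × ℝ => charValue Q V₀ p.2 p.1 :=
  contDiff_pi.2 fun i => ContDiff.sum (s := Finset.univ) fun j _ =>
    ((contDiff_exp_smul_apply Q i j).comp contDiff_fst).mul
      (((contDiff_pi.1 hV₀) j).comp contDiff_snd)

include hV hr in
/-- Differentiating `V (t, X (t, x₀)) = exp (t Q) V₀ (x₀)` with respect to `x₀`. -/
theorem decisive_smul_spaceDeriv (hA : IsUnit A.det) (hV₀ : ContDiff ℝ 2 V₀) {x₀ t : ℝ}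
    (ht : 0 ≤ t) (hU : ∀ s ∈ Icc 0 t, (s, charPos Q V₀ x₀ s) ∈ U) :
    decisive Q A V₀ x₀ t • spaceDeriv V (t, charPos Q V₀ x₀ t) =
      NormedSpace.exp (t • Q) *ᵥ deriv V₀ x₀ := by
  obtain ⟨O, hO, hUO⟩ := hV.isRelOpen
  have hdV₀ : DifferentiableAt ℝ V₀ x₀ := hV₀.differentiable (by norm_num) x₀
  -- By compactness of [0, t], characteristics from nearby points also stay in the domain up to time
  -- t, so the identity V = `charValue` holds near x₀ and can be differentiated.
  have hev : ∀ᶠ y in 𝓝 x₀, ∀ s ∈ Icc 0 t, (s, charPos Q V₀ y s) ∈ O := by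
    refine isCompact_Icc.eventually_forall_of_forall_eventually fun s hs => ?_
    have hcont : Continuous fun z : ℝ × ℝ => (z.2, charPos Q V₀ z.1 z.2) :=
      continuous_snd.prodMk ((contDiff_charPos hV₀).continuous.comp continuous_swap)
    exact hcont.continuousAt.eventually (hO.mem_nhds (hUO ▸ hU s hs).1)
  have heq : (fun y => V (t, charPos Q V₀ y t)) =ᶠ[𝓝 x₀] fun y => charValue Q V₀ y t := by
    filter_upwards [hev] with y hy
    refine hV.eq_charValue hr ht fun s hs => ?_
    rw [hUO]
    exact ⟨hy s hs, hs.1⟩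
  have h1 := (hasDerivAt_charValue_space (Q := Q) t hdV₀).congr_of_eventuallyEq heq
  have h2 := (hV.hasDerivAt_spaceDeriv hr (hU t ⟨ht, le_rfl⟩)).scomp x₀
    (hasDerivAt_charPos_space (Q := Q) t hdV₀)
  rw [decisive_eq hA ht]
  exact h2.unique h1

include hV hr in
-- If q = 0, then exp(tQ) V₀'(x₀) = 0; the exponential is invertible, so V₀'(x₀) = 0, and then the
-- formula for q gives q = 1.
theorem decisive_ne_zero (hA : IsUnit A.det) (hV₀ : ContDiff ℝ 2 V₀) {x₀ t : ℝ}
    (ht : 0 ≤ t) (hU : ∀ s ∈ Icc 0 t, (s, charPos Q V₀ x₀ s) ∈ U) :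
    decisive Q A V₀ x₀ t ≠ 0 := by
  intro h0
  have h := decisive_smul_spaceDeriv hV hr hA hV₀ ht hU
  rw [h0, zero_smul] at h
  have hd : deriv V₀ x₀ = 0 := by
    apply Matrix.mulVec_injective_of_isUnit (Matrix.isUnit_exp (t • Q))
    rw [Matrix.mulVec_zero, ← h]
  rw [decisive_eq hA ht, hd, dotProduct_zero] at h0
  norm_num at h0

include hV hr in
theorem spaceDeriv_eq_inv_decisive_smul (hA : IsUnit A.det) (hV₀ : ContDiff ℝ 2 V₀) {x₀ t : ℝ}
    (ht : 0 ≤ t) (hU : ∀ s ∈ Icc 0 t, (s, charPos Q V₀ x₀ s) ∈ U) :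
    spaceDeriv V (t, charPos Q V₀ x₀ t) =
      (decisive Q A V₀ x₀ t)⁻¹ • (NormedSpace.exp (t • Q) *ᵥ deriv V₀ x₀) := by
  rw [← decisive_smul_spaceDeriv hV hr hA hV₀ ht hU,
    inv_smul_smul₀ (decisive_ne_zero hV hr hA hV₀ ht hU)]

include hV hr in
theorem IsCharacteristic.solution_along (hA : IsUnit A.det) (hV₀ : ContDiff ℝ 2 V₀) {x₀ : ℝ}
    {τ : EReal} (hτ : 0 < τ) {ξ : ℝ → ℝ} (hξ : IsCharacteristic U V x₀ τ ξ) {t : ℝ}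
    (ht : 0 ≤ t) (htτ : (t : EReal) < τ) :
    V (t, ξ t) = charValue Q V₀ x₀ t ∧ 0 < decisive Q A V₀ x₀ t ∧
      spaceDeriv V (t, ξ t) = A⁻¹ *ᵥ radonQuotient Q A V₀ x₀ t := by
  have h := (isCharacteristic_iff hV hr hτ ξ).1 hξ
  have hU : ∀ t : ℝ, (t : EReal) < τ → ∀ s ∈ Icc 0 t, (s, charPos Q V₀ x₀ s) ∈ U :=
    fun t ht s hs => (h s hs.1 ((EReal.coe_le_coe_iff.2 hs.2).trans_lt ht)).2
  rw [(h t ht htτ).1, inv_mulVec_radonQuotient hA ht]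
  exact ⟨hV.eq_charValue hr ht (hU t htτ),
    decisive_pos (fun s hs hsτ => decisive_ne_zero hV hr hA hV₀ hs.le (hU s hsτ)) ht htτ,
    spaceDeriv_eq_inv_decisive_smul hV hr hA hV₀ ht (hU t htτ)⟩

end Solutions

/-! ### Construction of the solution by inverting the characteristic map -/

section Construction

variable {Q A : Matrix (Fin 2) (Fin 2) ℝ} {V₀ : ℝ → Fin 2 → ℝ} {r : ℕ} {T : EReal}

variable (Q V₀) in
/-- The map `(t, x₀) ↦ (t, X (t, x₀))`. -/
def charMap (p : ℝ × ℝ) : ℝ × ℝ := (p.1, charPos Q V₀ p.2 p.1)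

variable (Q V₀) in
/-- The Jacobian determinant `1 + b(t) · V₀'(x₀)` of `charMap` at `(t, x₀)`; for `t ≥ 0` it is the
decisive function. -/
def charJacobian (p : ℝ × ℝ) : ℝ := 1 + flowIntegral Q p.1 ⬝ᵥ deriv V₀ p.2

theorem charJacobian_eq_decisive (hA : IsUnit A.det) {p : ℝ × ℝ} (hp : 0 ≤ p.1) :
    charJacobian Q V₀ p = decisive Q A V₀ p.2 p.1 :=
  (decisive_eq hA hp).symm

theorem contDiff_charMap (hV₀ : ContDiff ℝ 2 V₀) : ContDiff ℝ 2 (charMap Q V₀) :=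
  contDiff_fst.prodMk (contDiff_charPos hV₀)

theorem continuous_charJacobian (hV₀ : ContDiff ℝ 2 V₀) : Continuous (charJacobian Q V₀) := by
  have hd : Continuous (deriv V₀) := hV₀.continuous_deriv (by norm_num)
  have hb : ∀ j, Continuous fun s => flowIntegral Q s j := fun j =>
    (contDiff_flowIntegral Q j).continuous
  change Continuous fun p : ℝ × ℝ => 1 + ∑ j, flowIntegral Q p.1 j * deriv V₀ p.2 j
  exact continuous_const.add (continuous_finsetSum _ fun j _ =>
    ((hb j).comp continuous_fst).mul (((continuous_apply j).comp hd).comp continuous_snd))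

/-- The derivative is triangular with diagonal entries 1 and `charJacobian`, hence invertible; this
is the input of the inverse function theorem. -/
theorem exists_hasFDerivAt_charMap (hV₀ : ContDiff ℝ 2 V₀) {p : ℝ × ℝ}
    (hp : charJacobian Q V₀ p ≠ 0) :
    ∃ F : (ℝ × ℝ) ≃L[ℝ] ℝ × ℝ, HasFDerivAt (charMap Q V₀) (F : ℝ × ℝ →L[ℝ] ℝ × ℝ) p := by
  obtain ⟨t, y⟩ := p
  have hD : HasFDerivAt (fun p : ℝ × ℝ => charPos Q V₀ p.2 p.1) _ (t, y) :=
    ((contDiff_charPos hV₀).differentiable (by norm_num) (t, y)).hasFDerivAt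
  set D := fderiv ℝ (fun p : ℝ × ℝ => charPos Q V₀ p.2 p.1) (t, y)
  have hD1 : D (0, 1) = charJacobian Q V₀ (t, y) :=
    (hD.comp_hasDerivAt_of_eq y ((hasDerivAt_const y t).prodMk (hasDerivAt_id y)) rfl).unique
      (hasDerivAt_charPos_space t (hV₀.differentiable (by norm_num) y))
  have hinj : Function.Injective
      ((ContinuousLinearMap.fst ℝ ℝ ℝ).prod D : ℝ × ℝ →ₗ[ℝ] ℝ × ℝ) := by
    rw [← LinearMap.ker_eq_bot, LinearMap.ker_eq_bot']
    rintro ⟨a, b⟩ hab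
    obtain ⟨rfl, hb⟩ : a = 0 ∧ D (a, b) = 0 := by simpa [Prod.ext_iff] using hab
    have : D (0, b) = b * D (0, 1) := by
      rw [← smul_eq_mul, ← map_smul]; simp
    rw [this, hD1, mul_eq_zero, or_iff_left hp] at hb
    simp [hb]
  exact ⟨(LinearEquiv.ofInjectiveEndo _ hinj).toContinuousLinearEquiv, hasFDerivAt_fst.prodMk hD⟩

theorem swept_eq_image : swept Q V₀ T = charMap Q V₀ '' strip T := by
  ext p
  constructor
  · rintro ⟨y, t, ht, htT, rfl⟩
    exact ⟨(t, y), ⟨ht, htT⟩, rfl⟩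
  · rintro ⟨⟨t, y⟩, ⟨ht, htT⟩, rfl⟩
    exact ⟨y, t, ht, htT, rfl⟩

variable (hV₀ : ContDiff ℝ 2 V₀) (hpos : ∀ p ∈ strip T, 0 < charJacobian Q V₀ p)

include hV₀ in
-- Negative times are admitted deliberately: the image is then open in the whole plane, and since
-- the map preserves t, its trace on the half-plane is the swept set. The boundary t = 0 needs no
-- separate treatment.
theorem isOpen_charMap_image :
    IsOpen (charMap Q V₀ '' {p | (p.1 : EReal) < T ∧ 0 < charJacobian Q V₀ p}) := by
  have hO : IsOpen {p : ℝ × ℝ | (p.1 : EReal) < T ∧ 0 < charJacobian Q V₀ p} :=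
    (isOpen_lt (continuous_coe_real_ereal.comp continuous_fst) continuous_const).inter
      (isOpen_lt continuous_const (continuous_charJacobian hV₀))
  rw [isOpen_iff_mem_nhds]
  rintro _ ⟨p, hp, rfl⟩
  obtain ⟨F, hF⟩ := exists_hasFDerivAt_charMap hV₀ hp.2.ne'
  rw [← ((contDiff_charMap hV₀).contDiffAt.hasStrictFDerivAt' hF
    (by norm_num)).map_nhds_eq_of_equiv]
  exact image_mem_map (hO.mem_nhds hp)

include hV₀ hpos

theorem isRelOpen_swept : IsRelOpen (swept Q V₀ T) := by
  refine ⟨_, isOpen_charMap_image (Q := Q) (T := T) hV₀, ?_⟩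
  rw [swept_eq_image]
  ext z
  constructor
  · rintro ⟨p, hp, rfl⟩
    exact ⟨⟨p, ⟨hp.2, hpos p hp⟩, rfl⟩, hp.1⟩
  · rintro ⟨⟨p, hp, rfl⟩, hz⟩
    exact ⟨p, ⟨hz, hp.1⟩, rfl⟩

/-- At a fixed time the Jacobian is positive on all of ℝ, so X(t, ·) is strictly increasing. -/
theorem injOn_charMap : InjOn (charMap Q V₀) (strip T) := by
  rintro ⟨t, y⟩ hp ⟨t', y'⟩ - heq
  obtain rfl : t = t' := congrArg Prod.fst heq
  have hd : ∀ y, HasDerivAt (fun y => charPos Q V₀ y t) (charJacobian Q V₀ (t, y)) y := fun y =>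
    hasDerivAt_charPos_space t (hV₀.differentiable (by norm_num) y)
  have hmono : StrictMono fun y => charPos Q V₀ y t :=
    strictMono_of_deriv_pos fun y => by
      rw [(hd y).deriv]
      exact hpos (t, y) hp
  exact Prod.ext rfl (hmono.injective (congrArg Prod.snd heq))

omit hV₀ hpos in
variable (Q V₀ T) in
/-- The solution on the set swept out by the characteristics, transported along them. -/
def sweptSolution (z : ℝ × ℝ) : Fin 2 → ℝ :=
  charValue Q V₀ (Function.invFunOn (charMap Q V₀) (strip T) z).2
    (Function.invFunOn (charMap Q V₀) (strip T) z).1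

theorem sweptSolution_charMap {p : ℝ × ℝ} (hp : p ∈ strip T) :
    sweptSolution Q V₀ T (charMap Q V₀ p) = charValue Q V₀ p.2 p.1 := by
  rw [sweptSolution, (injOn_charMap hV₀ hpos).leftInvOn_invFunOn hp]

/-- By injectivity, the global inverse agrees on the swept set with the C² local inverse `G`. As
`charMap` preserves time, `G` maps nearby swept points back into the strip. -/
theorem contDiffOn_sweptSolution :
    ContDiffOn ℝ 2 (sweptSolution Q V₀ T) (swept Q V₀ T) := by
  rw [swept_eq_image]
  rintro _ ⟨p, hp, rfl⟩
  obtain ⟨F, hF⟩ := exists_hasFDerivAt_charMap hV₀ (hpos p hp).ne'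
  have hc := (contDiff_charMap (Q := Q) hV₀).contDiffAt (x := p)
  have hs := hc.hasStrictFDerivAt' hF (by norm_num)
  set G := hc.localInverse hF (by norm_num)
  have hGp : G (charMap Q V₀ p) = p := hc.localInverse_apply_image hF (by norm_num)
  have hG : ContDiffAt ℝ 2 G (charMap Q V₀ p) := hc.to_localInverse hF (by norm_num)
  have hT : ∀ᶠ z in 𝓝 (charMap Q V₀ p), ((G z).1 : EReal) < T :=
    (continuous_coe_real_ereal.continuousAt.comp
      (continuous_fst.continuousAt.comp hG.continuousAt)).eventually_lt_const
      (by simpa [hGp] using hp.2)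
  refine ((contDiff_charValue (Q := Q)
    hV₀).contDiffAt.comp _ hG).contDiffWithinAt.congr_of_eventuallyEq ?_ ?_
  · filter_upwards [self_mem_nhdsWithin, mem_nhdsWithin_of_mem_nhds hT,
      mem_nhdsWithin_of_mem_nhds hs.eventually_right_inverse] with z hz hzT hGz
    have hGz' : charMap Q V₀ (G z) = z := hGz
    obtain ⟨p', hp', rfl⟩ := hz
    have hmem : G (charMap Q V₀ p') ∈ strip T := by
      refine ⟨?_, hzT⟩
      rw [show (G (charMap Q V₀ p')).1 = p'.1 from (Prod.ext_iff.1 hGz').1]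
      exact hp'.1
    conv_lhs => rw [← hGz']
    exact sweptSolution_charMap hV₀ hpos hmem
  · simp only [Function.comp_apply, hGp]
    exact sweptSolution_charMap hV₀ hpos hp

theorem isSolutionOn_swept (hr : r ≤ 2) :
    IsSolutionOn Q V₀ r (swept Q V₀ T) (sweptSolution Q V₀ T) where
  isRelOpen := isRelOpen_swept hV₀ hpos
  contDiffOn := (contDiffOn_sweptSolution hV₀ hpos).of_le (by exact_mod_cast hr)
  pde z hz := by
    have hd := ((contDiffOn_sweptSolution hV₀ hpos).differentiableOn (by norm_num) z
      hz).hasFDerivWithinAt.mono_of_mem_nhdsWithin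
        ((isRelOpen_swept hV₀ hpos).mem_nhdsWithin hz)
    obtain ⟨y, t, ht, htT, rfl⟩ := hz
    have hval : ∀ s : ℝ, 0 ≤ s → (s : EReal) < T →
        sweptSolution Q V₀ T (s, charPos Q V₀ y s) = charValue Q V₀ y s := fun s hs hsT =>
      sweptSolution_charMap hV₀ hpos (p := (s, y)) ⟨hs, hsT⟩
    rw [timeDeriv_eq hd ht, spaceDeriv_eq hd ht, hval t ht htT]
    -- The derivative along the characteristic is computed twice: by the chain rule it is V_t + V₁
    -- V_x, and from the transported values it is QV.
    refine (uniqueDiffOn_Ici 0 t ht).eq_deriv _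
      (hasDerivWithinAt_along hd subset_rfl rfl (hasDerivAt_charPos Q V₀ y t).hasDerivWithinAt)
      ((hasDerivAt_charValue Q V₀ y t).hasDerivWithinAt.congr_of_eventuallyEq ?_ (hval t ht htT))
    filter_upwards [self_mem_nhdsWithin, mem_nhdsWithin_of_mem_nhds (eventually_coe_lt htT)]
      with s hs hsT using hval s hs hsT
  init x hx := by
    obtain ⟨y, t, -, htT, h⟩ := hx
    obtain rfl : 0 = t := congrArg Prod.fst h
    obtain rfl : x = charPos Q V₀ y 0 := congrArg Prod.snd h
    have := sweptSolution_charMap hV₀ hpos (p := (0, y)) ⟨le_rfl, htT⟩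
    simpa [charMap] using this

end Construction

/-! ### Criteria for smoothness on the swept set and on the strip -/

section Criteria

variable {Q A : Matrix (Fin 2) (Fin 2) ℝ} {V₀ : ℝ → Fin 2 → ℝ} {r : ℕ} {T : EReal}

theorem le_blowupTime_iff : T ≤ blowupTime Q A V₀ ↔
    ∀ x₀ t : ℝ, 0 < t → (t : EReal) < T → decisive Q A V₀ x₀ t ≠ 0 := by
  simp only [blowupTime, le_sInf_iff, mem_ofPred_eq]
  constructor
  · intro h x₀ t ht htT h0
    exact htT.not_ge (h _ ⟨x₀, t, ht, h0, rfl⟩)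
  · rintro h _ ⟨x₀, t, ht, h0, rfl⟩
    by_contra! hlt
    exact h x₀ t ht hlt h0

theorem decisive_pos_of_lt_blowupTime {x₀ t : ℝ} (ht : 0 ≤ t)
    (h : (t : EReal) < blowupTime Q A V₀) : 0 < decisive Q A V₀ x₀ t :=
  decisive_pos (le_blowupTime_iff.1 le_rfl x₀) ht h

theorem charPos_mem_of_swept_subset {U : Set (ℝ × ℝ)} (hU : swept Q V₀ T ⊆ U) {x₀ t : ℝ}
    (ht : (t : EReal) < T) : ∀ s ∈ Icc 0 t, (s, charPos Q V₀ x₀ s) ∈ U := fun s hs =>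
  hU ⟨x₀, s, hs.1, (EReal.coe_le_coe_iff.2 hs.2).trans_lt ht, rfl⟩

theorem isSolutionOn_swept_of_le_blowupTime (hA : IsUnit A.det) (hV₀ : ContDiff ℝ 2 V₀)
    (hr : r ≤ 2) (hT : T ≤ blowupTime Q A V₀) :
    IsSolutionOn Q V₀ r (swept Q V₀ T) (sweptSolution Q V₀ T) := by
  refine isSolutionOn_swept hV₀ (fun p hp => ?_) hr
  rw [charJacobian_eq_decisive hA hp.1]
  exact decisive_pos_of_lt_blowupTime hp.1 (hp.2.trans_le hT)

theorem smoothOnSwept_iff (hA : IsUnit A.det) (hV₀ : ContDiff ℝ 2 V₀) (hr1 : 1 ≤ r)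
    (hr2 : r ≤ 2) : SmoothOnSwept Q V₀ r T ↔ T ≤ blowupTime Q A V₀ := by
  constructor
  · rintro ⟨U, V, hV, hU⟩
    exact le_blowupTime_iff.2 fun x₀ t ht htT =>
      decisive_ne_zero hV hr1 hA hV₀ ht.le (charPos_mem_of_swept_subset hU htT)
  · exact fun hT => ⟨_, _, isSolutionOn_swept_of_le_blowupTime hA hV₀ hr2 hT, subset_rfl⟩

theorem swept_subset_strip : swept Q V₀ T ⊆ strip T := by
  rintro _ ⟨x₀, t, ht, htT, rfl⟩
  exact ⟨ht, htT⟩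

/-- Every point of the strip is reached by the characteristic traced back from it. -/
theorem IsSolutionOn.surjective_charPos {V : ℝ × ℝ → Fin 2 → ℝ}
    (hV : IsSolutionOn Q V₀ r (strip T) V) (hr : 1 ≤ r) {t : ℝ} (ht : 0 ≤ t)
    (htT : (t : EReal) < T) : Function.Surjective fun x₀ => charPos Q V₀ x₀ t := by
  intro x
  have hstrip : ∀ γ : ℝ → ℝ, ∀ s ∈ Icc 0 t, (s, γ s) ∈ strip T := fun γ s hs =>
    ⟨hs.1, (EReal.coe_le_coe_iff.2 hs.2).trans_lt htT⟩
  -- `w` is the initial value whose linear evolution equals V(t, x) at time t, and `γ` is the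
  -- corresponding path ending at x. Backward uniqueness gives V(0, γ(0)) = w, so w = V₀(γ(0)) and
  -- `γ` is the characteristic from γ(0).
  set w := (NormedSpace.exp (t • Q))⁻¹ *ᵥ V (t, x) with hw
  set γ := fun s => x + (flowIntegral Q s ⬝ᵥ w - flowIntegral Q t ⬝ᵥ w) with hγ
  have h := hV.eq_along hr le_rfl (b := t) (c := fun s => NormedSpace.exp (s • Q) *ᵥ w) (γ := γ)
    (hasDerivAt_exp_smul_mulVec Q w)
    (fun s => ((hasDerivAt_flowIntegral_dotProduct Q s w).sub_const _).const_add x) (hstrip γ)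
    (.inr ?_) 0 ⟨le_rfl, ht⟩
  · rw [hV.init _ (hstrip γ 0 ⟨le_rfl, ht⟩), zero_smul, NormedSpace.exp_zero,
      Matrix.one_mulVec] at h
    refine ⟨γ 0, ?_⟩
    simp only [charPos_eq, h]
    simp only [hγ, flowIntegral_zero, zero_dotProduct]
    ring
  · have : γ t = x := by simp [hγ]
    have hdet := (Matrix.isUnit_iff_isUnit_det _).1 (Matrix.isUnit_exp (t • Q))
    rw [this, hw, Matrix.mulVec_mulVec, Matrix.mul_nonsing_inv _ hdet, Matrix.one_mulVec]

theorem smoothOnStrip_iff (hA : IsUnit A.det) (hV₀ : ContDiff ℝ 2 V₀) (hr1 : 1 ≤ r)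
    (hr2 : r ≤ 2) : SmoothOnStrip Q V₀ r T ↔ T ≤ blowupTime Q A V₀ ∧
      ∀ t : ℝ, 0 ≤ t → (t : EReal) < T → Function.Surjective (fun x₀ => charPos Q V₀ x₀ t) := by
  constructor
  · rintro ⟨V, hV⟩
    exact ⟨(smoothOnSwept_iff hA hV₀ hr1 hr2).1 ⟨_, _, hV, swept_subset_strip⟩,
      fun t ht htT => hV.surjective_charPos hr1 ht htT⟩
  · rintro ⟨hT, hsurj⟩
    have : strip T = swept Q V₀ T := by
      refine subset_antisymm (fun p hp => ?_) swept_subset_strip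
      obtain ⟨y, hy⟩ := hsurj p.1 hp.1 hp.2 p.2
      exact ⟨y, p.1, hp.1, hp.2, Prod.ext rfl hy.symm⟩
    refine ⟨sweptSolution Q V₀ T, ?_⟩
    rw [this]
    exact isSolutionOn_swept_of_le_blowupTime hA hV₀ hr2 hT

/-- Here X(t, y) = y + o(|y|) tends to ±∞ with y, and continuity in y does the rest. -/
theorem surjective_charPos_of_isLittleO (hV₀ : ContDiff ℝ 2 V₀)
    (ho : V₀ =o[cocompact ℝ] (fun x : ℝ => x)) (t : ℝ) :
    Function.Surjective fun x₀ => charPos Q V₀ x₀ t := by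
  have hdot : (fun y => flowIntegral Q t ⬝ᵥ V₀ y) =o[cocompact ℝ] (fun y : ℝ => y) := by
    simp only [dotProduct]
    exact IsLittleO.fun_sum fun j _ => (isLittleO_pi.1 ho j).const_mul_left _
  rw [cocompact_eq_atBot_atTop, isLittleO_sup] at hdot
  have heq : ∀ {l : Filter ℝ}, (fun y => flowIntegral Q t ⬝ᵥ V₀ y) =o[l] (fun y : ℝ => y) →
      (fun y : ℝ => y) ~[l] fun y => charPos Q V₀ y t := fun h => by
    refine IsEquivalent.symm ?_
    simpa [IsEquivalent, charPos_eq, Pi.sub_def] using h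
  exact ((contDiff_charPos hV₀).continuous.comp (Continuous.prodMk_right t)).surjective
    ((heq hdot.2).tendsto_atTop tendsto_id) ((heq hdot.1).tendsto_atBot tendsto_id)

end Criteria

/-! ### Blow-up of the derivatives -/

/-- To the left of a zero, the logarithmic derivative of an analytic function tends to `-∞`. -/
theorem tendsto_deriv_div_self_atBot {f : ℝ → ℝ} (hf : ∀ t, AnalyticAt ℝ f t) {s t : ℝ}
    (hs : f s ≠ 0) (ht : f t = 0) :
    Tendsto (fun z => (f z)⁻¹ * deriv f z) (𝓝[<] t) atBot := by
  -- By the identity theorem the zero at t has finite order, because f(s) ≠ 0.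
  have hne : ¬∀ᶠ z in 𝓝 t, f z = 0 := fun h => hs <|
    AnalyticOnNhd.eqOn_zero_of_preconnected_of_eventuallyEq_zero (fun z _ => hf z)
      isPreconnected_univ (mem_univ t) h (mem_univ s)
  obtain ⟨n, g, hg, hg0, hfg⟩ := (hf t).exists_eventuallyEq_pow_smul_nonzero_iff.2 hne
  have hn : n ≠ 0 := by
    rintro rfl
    have := hfg.self_of_nhds
    simp [ht, hg0.symm] at this
  -- With f = (z - t)ⁿ g and g(t) ≠ 0, f'/f = n/(z - t) + g'/g, and the last term converges.
  have hmain : Tendsto (fun z => (n : ℝ) * (z - t)⁻¹ + (g z)⁻¹ * deriv g z) (𝓝[<] t) atBot := by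
    have h1 : Tendsto (fun z : ℝ => z - t) (𝓝[<] t) (𝓝[<] 0) := by
      refine tendsto_nhdsWithin_iff.2 ⟨?_, ?_⟩
      · exact tendsto_nhdsWithin_of_tendsto_nhds
          (by simpa using (continuous_sub_right t).tendsto t)
      · filter_upwards [self_mem_nhdsWithin] with z hz
        exact mem_Iio.2 (sub_neg.2 (mem_Iio.1 hz))
    have h2 : Tendsto (fun z => (g z)⁻¹ * deriv g z) (𝓝[<] t) (𝓝 ((g t)⁻¹ * deriv g t)) :=
      tendsto_nhdsWithin_of_tendsto_nhds
        ((hg.continuousAt.inv₀ hg0).mul hg.deriv.continuousAt)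
    exact ((tendsto_inv_nhdsLT_zero.comp h1).const_mul_atBot
      (by positivity : (0 : ℝ) < n)).atBot_add h2
  refine hmain.congr' ?_
  filter_upwards [self_mem_nhdsWithin, mem_nhdsWithin_of_mem_nhds hfg.eventually_nhds,
    mem_nhdsWithin_of_mem_nhds (hg.continuousAt.eventually_ne hg0),
    mem_nhdsWithin_of_mem_nhds hg.eventually_analyticAt] with z hz hfz hgz hga
  have hzt : z - t ≠ 0 := sub_ne_zero.2 (ne_of_lt hz)
  have hd := (((hasDerivAt_id z).sub_const t).pow n).mul hga.differentiableAt.hasDerivAt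
  rw [hfz.self_of_nhds, EventuallyEq.deriv_eq hfz]
  have hd' : deriv (fun z => (z - t) ^ n • g z) z = _ := hd.deriv
  rw [hd']
  obtain ⟨k, rfl⟩ := Nat.exists_eq_succ_of_ne_zero hn
  simp only [id, smul_eq_mul, Nat.succ_sub_one, Pi.pow_apply]
  rw [Nat.succ_eq_add_one, pow_succ]
  field_simp

section BlowUp

variable {Q A : Matrix (Fin 2) (Fin 2) ℝ} {V₀ : ℝ → Fin 2 → ℝ} {r : ℕ} {U : Set (ℝ × ℝ)}
  {V : ℝ × ℝ → Fin 2 → ℝ} {x₀ t : ℝ}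

theorem hasDerivWithinAt_decisive (hA : IsUnit A.det) (ht : 0 ≤ t) :
    HasDerivWithinAt (decisive Q A V₀ x₀) ((NormedSpace.exp (t • Q) *ᵥ deriv V₀ x₀) 0)
      (Ici 0) t :=
  ((hasDerivAt_flowIntegral_dotProduct Q t (deriv V₀ x₀)).const_add 1).hasDerivWithinAt.congr
    (fun _ hs => decisive_eq hA hs) (decisive_eq hA ht)

theorem deriv_decisive (hA : IsUnit A.det) (ht : 0 < t) :
    deriv (decisive Q A V₀ x₀) t = (NormedSpace.exp (t • Q) *ᵥ deriv V₀ x₀) 0 :=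
  ((hasDerivWithinAt_decisive hA ht.le).hasDerivAt (Ici_mem_nhds ht)).deriv

/-- At a zero of the decisive function `∂V₁/∂x` tends to `-∞` along the characteristic. -/
theorem IsSolutionOn.tendsto_spaceDeriv_atBot (hV : IsSolutionOn Q V₀ r U V) (hr : 1 ≤ r)
    (hA : IsUnit A.det) (hV₀ : ContDiff ℝ 2 V₀) {t₁ : ℝ} (ht₁ : 0 < t₁)
    (hq : decisive Q A V₀ x₀ t₁ = 0) (hU : ∀ t ∈ Ico 0 t₁, (t, charPos Q V₀ x₀ t) ∈ U) :
    Tendsto (fun t => spaceDeriv V (t, charPos Q V₀ x₀ t) 0) (𝓝[<] t₁) atBot := by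
  -- The first component of exp(tQ) V₀'(x₀) is q', hence (V₁)_x = q'/q.
  refine (tendsto_deriv_div_self_atBot (f := decisive Q A V₀ x₀) (s := 0)
    (fun _ => analyticAt_decisive) (by simp) hq).congr' ?_
  filter_upwards [Ioo_mem_nhdsLT ht₁] with t ht
  rw [spaceDeriv_eq_inv_decisive_smul hV hr hA hV₀ ht.1.le
    fun s hs => hU s ⟨hs.1, hs.2.trans_lt ht.2⟩, deriv_decisive hA ht.1]
  rfl

theorem exp_smul_mulVec_add (s : ℝ) (v : Fin 2 → ℝ) :
    NormedSpace.exp ((s + t) • Q) *ᵥ v =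
      NormedSpace.exp (s • Q) *ᵥ (NormedSpace.exp (t • Q) *ᵥ v) := by
  rw [add_smul, Matrix.exp_add_of_commute _ _ (((Commute.refl Q).smul_left s).smul_right t),
    Matrix.mulVec_mulVec]

variable (Q) in
theorem exists_bound_exp_smul_mulVec : ∃ C, 0 ≤ C ∧ ∀ s ∈ Icc (0 : ℝ) 1, ∀ v : Fin 2 → ℝ,
    |(NormedSpace.exp (s • Q) *ᵥ v) 0| ≤ C * ‖v‖ := by
  have hcont : Continuous fun s : ℝ =>
      |NormedSpace.exp (s • Q) 0 0| + |NormedSpace.exp (s • Q) 0 1| :=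
    (continuous_exp_smul_apply Q 0 0).abs.add (continuous_exp_smul_apply Q 0 1).abs
  obtain ⟨C, hC⟩ := isCompact_Icc.exists_bound_of_continuousOn (s := Icc (0 : ℝ) 1)
    hcont.continuousOn
  refine ⟨C, (norm_nonneg _).trans (hC 0 ⟨le_rfl, zero_le_one⟩), fun s hs v => ?_⟩
  have h := (le_abs_self _).trans (hC s hs)
  have h0 : |v 0| ≤ ‖v‖ := norm_le_pi_norm v 0
  have h1 : |v 1| ≤ ‖v‖ := norm_le_pi_norm v 1
  rw [mulVec_two]
  calc _ ≤ _ := abs_add_le _ _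
    _ = |NormedSpace.exp (s • Q) 0 0| * |v 0| + |NormedSpace.exp (s • Q) 0 1| * |v 1| := by
      rw [abs_mul, abs_mul]
    _ ≤ |NormedSpace.exp (s • Q) 0 0| * ‖v‖ + |NormedSpace.exp (s • Q) 0 1| * ‖v‖ := by gcongr
    _ ≤ C * ‖v‖ := by rw [← add_mul]; gcongr

/-- A bound for `∂V/∂x` at one point of a characteristic keeps the decisive function away from
zero for a time which depends on that bound only. -/
theorem decisive_ne_zero_of_norm_le (hA : IsUnit A.det) {C M t' : ℝ} (hC0 : 0 ≤ C)
    (hC : ∀ s ∈ Icc (0 : ℝ) 1, ∀ v : Fin 2 → ℝ,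
      |(NormedSpace.exp (s • Q) *ᵥ v) 0| ≤ C * ‖v‖) (ht : 0 ≤ t)
    (hq : 0 < decisive Q A V₀ x₀ t)
    (hM : ‖(decisive Q A V₀ x₀ t)⁻¹ • (NormedSpace.exp (t • Q) *ᵥ deriv V₀ x₀)‖ ≤ M)
    (htt' : t ≤ t') (h1 : t' - t ≤ 1) (h2 : C * M * (t' - t) < 1) :
    decisive Q A V₀ x₀ t' ≠ 0 := by
  set q := decisive Q A V₀ x₀ t
  have hnorm : ‖NormedSpace.exp (t • Q) *ᵥ deriv V₀ x₀‖ ≤ M * q := by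
    rwa [norm_smul, norm_inv, Real.norm_of_nonneg hq.le, inv_mul_le_iff₀ hq, mul_comm] at hM
  -- By the semigroup property, q'(s) is the first component of exp((s - t)Q) applied to exp(tQ)
  -- V₀'(x₀), so |q'(s)| ≤ C M q(t). Hence q loses less than q(t) on [t, t'].
  have hmv := norm_image_sub_le_of_norm_deriv_le_segment' (f := decisive Q A V₀ x₀)
    (a := t) (b := t') (C := C * (M * q))
    (fun s hs => (hasDerivWithinAt_decisive hA (ht.trans hs.1)).mono
      fun z hz => ht.trans hz.1)
    (fun s hs => by
      have := hC (s - t) ⟨sub_nonneg.2 hs.1, by linarith [hs.2]⟩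
        (NormedSpace.exp (t • Q) *ᵥ deriv V₀ x₀)
      rw [← exp_smul_mulVec_add, sub_add_cancel] at this
      exact this.trans (by gcongr)) t' ⟨htt', le_rfl⟩
  intro h0
  rw [h0, zero_sub, norm_neg, Real.norm_of_nonneg hq.le] at hmv
  nlinarith [mul_lt_mul_of_pos_right h2 hq]

/-- At `T_*` the derivatives of the solution are unbounded. -/
theorem IsSolutionOn.eventually_exists_lt_norm_spaceDeriv (hV : IsSolutionOn Q V₀ r U V)
    (hr : 1 ≤ r) (hA : IsUnit A.det) (hV₀ : ContDiff ℝ 2 V₀) {T : ℝ} (hT : 0 < T)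
    (hblow : blowupTime Q A V₀ = (T : EReal)) (hU : swept Q V₀ T ⊆ U) (M : ℝ) :
    ∀ᶠ t in 𝓝[<] T, ∃ x₀ : ℝ, M < ‖spaceDeriv V (t, charPos Q V₀ x₀ t)‖ := by
  obtain ⟨C, hC0, hC⟩ := exists_bound_exp_smul_mulVec Q
  -- A zero t' < T + δ and a time t > T - δ are less than 2δ apart, which explains the factor 2. `M`
  -- may be negative, hence the absolute value.
  obtain ⟨δ, hδ, hδ1, hδ2⟩ : ∃ δ : ℝ, 0 < δ ∧ 2 * δ ≤ 1 ∧ C * |M| * (2 * δ) < 1 := by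
    have hpos : 0 < 1 + C * |M| := by positivity
    refine ⟨(1 + C * |M|)⁻¹ / 2, by positivity, ?_, ?_⟩
    · have : (1 + C * |M|)⁻¹ ≤ 1 :=
        inv_le_one_of_one_le₀ (by linarith [mul_nonneg hC0 (abs_nonneg M)])
      linarith
    · rw [mul_div_cancel₀ _ two_ne_zero, ← div_eq_mul_inv, div_lt_one hpos]
      linarith
  have hlt : blowupTime Q A V₀ < ((T + δ : ℝ) : EReal) := by
    rw [hblow]
    exact EReal.coe_lt_coe_iff.2 (by linarith)
  -- The infimum need not be attained, so a zero slightly after T is used; its x₀ serves all t in (T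
  -- - δ, T) with t > 0.
  obtain ⟨_, ⟨x₀, t', ht'0, hq', rfl⟩, ht'⟩ := sInf_lt_iff.1 hlt
  have hTt' : T ≤ t' := by
    have : blowupTime Q A V₀ ≤ (t' : EReal) := sInf_le ⟨x₀, t', ht'0, hq', rfl⟩
    rw [hblow] at this
    exact EReal.coe_le_coe_iff.1 this
  have ht'δ : t' < T + δ := EReal.coe_lt_coe_iff.1 ht'
  filter_upwards [Ioo_mem_nhdsLT (max_lt hT (by linarith : T - δ < T))] with t ht
  have ht0 : 0 ≤ t := (le_max_left _ _).trans ht.1.le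
  have htδ : T - δ < t := (le_max_right _ _).trans_lt ht.1
  have htT : (t : EReal) < (T : EReal) := EReal.coe_lt_coe_iff.2 ht.2
  refine ⟨x₀, ?_⟩
  by_contra! hM
  rw [spaceDeriv_eq_inv_decisive_smul hV hr hA hV₀ ht0
    (charPos_mem_of_swept_subset hU htT)] at hM
  refine decisive_ne_zero_of_norm_le hA hC0 hC ht0
    (decisive_pos_of_lt_blowupTime ht0 (hblow ▸ htT)) (hM.trans (le_abs_self M))
    (ht.2.le.trans hTt') (by linarith) (lt_of_le_of_lt ?_ hδ2) hq'
  gcongr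
  linarith

end BlowUp

end QuasilinearPair

end

open QuasilinearPair in
theorem theoremt2 (Q A : Matrix (Fin 2) (Fin 2) ℝ) (hA : IsUnit A.det)
    (V₀ : ℝ → Fin 2 → ℝ) (hV₀ : ContDiff ℝ 2 V₀) (r : ℕ) (hr : r = 1 ∨ r = 2) :
    -- Part 1: both linear systems are uniquely solvable for every `x₀` ...
    ((∀ x₀ : ℝ,
        SolvesCharSystem Q V₀ x₀ (charValue Q V₀ x₀) (charPos Q V₀ x₀) ∧
        (∀ v x, SolvesCharSystem Q V₀ x₀ v x →
          EqOn v (charValue Q V₀ x₀) (Ici 0) ∧ EqOn x (charPos Q V₀ x₀) (Ici 0)) ∧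
        SolvesRadonSystem Q A V₀ x₀ (radonSol Q A V₀ x₀) ∧
        (∀ y, SolvesRadonSystem Q A V₀ x₀ y → EqOn y (radonSol Q A V₀ x₀) (Ici 0))) ∧
      -- ... and describe the characteristics, the solution and its derivatives along them
      (∀ U V, IsSolutionOn Q V₀ r U V → ∀ (x₀ : ℝ) (τ : EReal), 0 < τ →
        (∀ ξ : ℝ → ℝ, IsCharacteristic U V x₀ τ ξ ↔
          ∀ t : ℝ, 0 ≤ t → (t : EReal) < τ →
            ξ t = charPos Q V₀ x₀ t ∧ (t, charPos Q V₀ x₀ t) ∈ U) ∧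
        (∀ ξ : ℝ → ℝ, IsCharacteristic U V x₀ τ ξ →
          ∀ t : ℝ, 0 ≤ t → (t : EReal) < τ →
            V (t, ξ t) = charValue Q V₀ x₀ t ∧
            0 < decisive Q A V₀ x₀ t ∧
            spaceDeriv V (t, ξ t) = A⁻¹ *ᵥ radonQuotient Q A V₀ x₀ t))) ∧
    -- Part 2: smoothness for all times
    ((SmoothOnSwept Q V₀ r ⊤ ↔ ∀ x₀ t : ℝ, 0 < t → decisive Q A V₀ x₀ t ≠ 0) ∧
      (SmoothOnStrip Q V₀ r ⊤ ↔
        (∀ x₀ t : ℝ, 0 < t → decisive Q A V₀ x₀ t ≠ 0) ∧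
          ∀ t : ℝ, 0 ≤ t → Function.Surjective (fun x₀ => charPos Q V₀ x₀ t)) ∧
      (V₀ =o[cocompact ℝ] (fun x : ℝ => x) →
        (SmoothOnStrip Q V₀ r ⊤ ↔ ∀ x₀ t : ℝ, 0 < t → decisive Q A V₀ x₀ t ≠ 0))) ∧
    -- Part 3: the time of the singularity ...
    (((∃ x₀ t : ℝ, 0 < t ∧ decisive Q A V₀ x₀ t = 0) → blowupTime Q A V₀ < ⊤) ∧
      (∀ T : EReal, 0 < T →
        (SmoothOnSwept Q V₀ r T ↔ T ≤ blowupTime Q A V₀) ∧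
        (SmoothOnStrip Q V₀ r T ↔ T ≤ blowupTime Q A V₀ ∧
          ∀ t : ℝ, 0 ≤ t → (t : EReal) < T →
            Function.Surjective (fun x₀ => charPos Q V₀ x₀ t)) ∧
        (V₀ =o[cocompact ℝ] (fun x : ℝ => x) →
          (SmoothOnStrip Q V₀ r T ↔ T ≤ blowupTime Q A V₀))) ∧
      -- ... where the derivatives tend to infinity: along a single characteristic at the first
      -- zero of its decisive function, and uniformly over all characteristics at `T_*`
      (∀ U V, IsSolutionOn Q V₀ r U V → ∀ x₀ t₁ : ℝ, 0 < t₁ → decisive Q A V₀ x₀ t₁ = 0 →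
        (∀ t ∈ Ico 0 t₁, decisive Q A V₀ x₀ t ≠ 0 ∧ (t, charPos Q V₀ x₀ t) ∈ U) →
        Tendsto (fun t => spaceDeriv V (t, charPos Q V₀ x₀ t) 0) (𝓝[<] t₁) atBot) ∧
      (∀ T : ℝ, 0 < T → blowupTime Q A V₀ = (T : EReal) →
        ∀ U V, IsSolutionOn Q V₀ r U V → swept Q V₀ T ⊆ U →
          ∀ M : ℝ, ∀ᶠ t in 𝓝[<] T, ∃ x₀ : ℝ,
            M < ‖spaceDeriv V (t, charPos Q V₀ x₀ t)‖)) := by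
  have hr1 : 1 ≤ r := by omega
  have hr2 : r ≤ 2 := by omega
  have htop : ⊤ ≤ blowupTime Q A V₀ ↔ ∀ x₀ t : ℝ, 0 < t → decisive Q A V₀ x₀ t ≠ 0 := by
    simp only [le_blowupTime_iff, EReal.coe_lt_top, true_imp_iff]
  have hstrip : ∀ T : EReal, V₀ =o[cocompact ℝ] (fun x : ℝ => x) →
      (SmoothOnStrip Q V₀ r T ↔ T ≤ blowupTime Q A V₀) := fun T ho => by
    rw [smoothOnStrip_iff hA hV₀ hr1 hr2]
    exact and_iff_left fun t _ _ => surjective_charPos_of_isLittleO hV₀ ho t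
  refine ⟨⟨fun x₀ => ⟨solvesCharSystem Q V₀ x₀, fun v x h => h.eqOn,
      solvesRadonSystem Q A V₀ x₀, fun y h => h.eqOn⟩, fun U V hV x₀ τ hτ =>
      ⟨isCharacteristic_iff hV hr1 hτ, fun ξ hξ t ht htτ =>
        hξ.solution_along hV hr1 hA hV₀ hτ ht htτ⟩⟩,
    ⟨?_, ?_, fun ho => ?_⟩, ?_, fun T _ => ⟨smoothOnSwept_iff hA hV₀ hr1 hr2,
      smoothOnStrip_iff hA hV₀ hr1 hr2, hstrip T⟩,
    fun U V hV x₀ t₁ ht₁ hq h =>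
      hV.tendsto_spaceDeriv_atBot hr1 hA hV₀ ht₁ hq fun t ht => (h t ht).2,
    fun T hT hblow U V hV hU =>
      hV.eventually_exists_lt_norm_spaceDeriv hr1 hA hV₀ hT hblow hU⟩
  · rw [smoothOnSwept_iff hA hV₀ hr1 hr2, htop]
  · rw [smoothOnStrip_iff hA hV₀ hr1 hr2, htop]
    simp only [EReal.coe_lt_top, true_imp_iff]
  · rw [hstrip ⊤ ho, htop]
  · rintro ⟨x₀, t, ht, hq⟩
    exact (sInf_le ⟨x₀, t, ht, hq, rfl⟩ : blowupTime Q A V₀ ≤ (t : EReal)).trans_lt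
      (EReal.coe_lt_top t)
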